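/- For $\alpha\in\mathbb{C}$ with $|\alpha|<1$ put $\Theta(\alpha)=\begin{pmatrix}\overline{\alpha}&\rho\\ \rho&-\alpha\end{pmatrix}$, $\rho=(1-|\alpha|^2)^{1/2}$. For $k\ge 0$, $\alpha_0,\dots,\alpha_{k-1}$ in the open unit disk and $b$ on the unit circle $\mathbb{S}^1$, let $\mathcal{C}(\alpha_0,\dots,\alpha_{k-1},b)=\mathcal{L}\mathcal{M}$ be the $(k+1)\times(k+1)$ matrix in which, writing $\Theta_j=\Theta(\alpha_j)$, $\mathcal{L}=\Theta_0\oplus\Theta_2\oplus\cdots\oplus\Theta_{k-2}\oplus\overline{b}$ and $\mathcal{M}=1\oplus\Theta_1\oplus\Theta_3\oplus\cdots\oplus\Theta_{k-1}$ if $k$ is even, and $\mathcal{L}=\Theta_0\oplus\Theta_2\oplus\cdots\oplus\Theta_{k-1}$ and $\mathcal{M}=1\oplus\Theta_1\oplus\Theta_3\oplus\cdots\oplus\Theta_{k-2}\oplus\overline{b}$ if $k$ is odd (so $\mathcal{C}(b)=\overline{b}$ for $k=0$). Write $\sigma(\cdot)$ for the spectrum, as a set. Two finite subsets $\{\zeta_1,\dots,\zeta_p\}$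 and $\{\xi_1,\dots,\xi_q\}$ of $\mathbb{S}^1$ with $p$ and $q$ elements respectively, $1\le p\le q$, strictly interlace if there are $q-p$ further points $\zeta_{p+1},\dots,\zeta_q\in\mathbb{S}^1$ such that any open arc of $\mathbb{S}^1$ connecting two distinct elements of $\{\zeta_1,\dots,\zeta_q\}$ contains at least one element of $\{\xi_1,\dots,\xi_q\}$, and vice versa. Let $n\ge1$, let $\alpha_0,\dots,\alpha_{n-1}\in\mathbb{C}$ with $|\alpha_j|<1$ for all $j$, let $b_n,b_{n-1}\in\mathbb{S}^1$, and put $$\gamma_{n-1}=\frac{\alpha_{n-1}-b_{n-1}}{\overline{\alpha}_{n-1}b_{n-1}-1},\qquad \sigma=\sigma\big(\mathcal{C}(\alpha_0,\dots,\alpha_{n-1},b_n)\big),\qquad \sigma'=\sigma\big(\mathcal{C}(\alpha_0,\dots,\alpha_{n-2},b_{n-1})\big).$$ Then $\mathcal{C}(\alpha_0,\dots,\alpha_{n-1},b_n)$ and $\mathcal{C}(\alpha_0,\dots,\alpha_{n-2},b_{n-1})$ have at most one common eigenvalue. More precisely, one of the following holds: (a) $\sigma\cap\sigma'=\{\overline{b}_n\gamma_{n-1}\}$,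 and the sets $\sigma\setminus\{\overline{b}_n\gamma_{n-1}\}$ and $\sigma'$ strictly interlace on $\mathbb{S}^1$; or (b) $\sigma\cap\sigma'=\emptyset$, the number $\overline{b}_n\gamma_{n-1}$ belongs to neither $\sigma$ nor $\sigma'$, and the sets $\sigma$ and $\sigma'\cup\{\overline{b}_n\gamma_{n-1}\}$ strictly interlace on $\mathbb{S}^1$. -/

import Mathlib

open scoped ComplexConjugate

noncomputable section

namespace CMV

/-- The unit circle `{z : |z| = 1}` in the complex plane. -/
def unitCircle : Set ℂ := {z | ‖z‖ = 1}

/-- The matrix `Θ(α)`, with `ρ = (1 - |α|²)^{1/2}`. -/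
def Theta (a : ℂ) : Matrix (Fin 2) (Fin 2) ℂ :=
  !![conj a, (Real.sqrt (1 - ‖a‖ ^ 2) : ℂ);
     (Real.sqrt (1 - ‖a‖ ^ 2) : ℂ), -a]

/-- The `(n+1)`-by-`(n+1)` matrix which has the 2-by-2 matrix `A` as its diagonal block in the
rows and columns `k, k+1` (counted from `0`), and zeros elsewhere. -/
def blockAt {n : ℕ} (k : Fin n) (A : Matrix (Fin 2) (Fin 2) ℂ) :
    Matrix (Fin (n + 1)) (Fin (n + 1)) ℂ :=
  Matrix.single k.castSucc k.castSucc (A 0 0) + Matrix.single k.castSucc k.succ (A 0 1) +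
    Matrix.single k.succ k.castSucc (A 1 0) + Matrix.single k.succ k.succ (A 1 1)

/-- `L = Θ₀ ⊕ Θ₂ ⊕ ⋯`, closed by the 1-by-1 block `conj b` when `n` is even. -/
def matL {n : ℕ} (α : Fin n → ℂ) (b : ℂ) : Matrix (Fin (n + 1)) (Fin (n + 1)) ℂ :=
  (∑ k : Fin n, if Even (k : ℕ) then blockAt k (Theta (α k)) else 0) +
    (if Even n then Matrix.single (Fin.last n) (Fin.last n) (conj b) else 0)

/-- `M = 1 ⊕ Θ₁ ⊕ Θ₃ ⊕ ⋯`, closed by the 1-by-1 block `conj b` when `n` is odd. -/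
def matM {n : ℕ} (α : Fin n → ℂ) (b : ℂ) : Matrix (Fin (n + 1)) (Fin (n + 1)) ℂ :=
  Matrix.single 0 0 1 + (∑ k : Fin n, if Odd (k : ℕ) then blockAt k (Theta (α k)) else 0) +
    (if Odd n then Matrix.single (Fin.last n) (Fin.last n) (conj b) else 0)

/-- The matrix `C(α₀, …, α_{n-1}, b) = L M`, of order `n + 1`. -/
def matC {n : ℕ} (α : Fin n → ℂ) (b : ℂ) : Matrix (Fin (n + 1)) (Fin (n + 1)) ℂ :=
  matL α b * matM α b

/-- The number `γ = (α - b) / (conj α * b - 1)`. -/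
def gam (a b : ℂ) : ℂ := (a - b) / (conj a * b - 1)

/-- The open arc of the unit circle that runs counterclockwise from `p` to `q`, for distinct
points `p`, `q` of the circle. The other open arc connecting them is `openArc q p`. -/
def openArc (p q : ℂ) : Set ℂ :=
  {z | ∃ s t : ℝ, 0 < s ∧ s < t ∧ t < 2 * Real.pi ∧
    z = p * Complex.exp (s * Complex.I) ∧ q = p * Complex.exp (t * Complex.I)}

/-- Any open arc connecting two distinct elements of `S` contains an element of `T`. -/
def ArcsMeet (S T : Set ℂ) : Prop :=
  ∀ p ∈ S, ∀ q ∈ S, p ≠ q → (openArc p q ∩ T).Nonempty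

/-- Strict interlacing of two finite subsets of the unit circle, the first one, `S`, having at
least one and at most as many elements as `T`: for some set `E` of points of the circle, obtained
from `S` by adding as many points as `T` has more than `S`, any open arc connecting two distinct
elements of `E` contains an element of `T`, and vice versa. -/
def StrictlyInterlaceLE (S T : Set ℂ) : Prop :=
  S.Finite ∧ T.Finite ∧ S ⊆ unitCircle ∧ T ⊆ unitCircle ∧ 1 ≤ S.ncard ∧ S.ncard ≤ T.ncard ∧
    ∃ E : Set ℂ, E.Finite ∧ S ⊆ E ∧ E ⊆ unitCircle ∧ E.ncard = T.ncard ∧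
      ArcsMeet E T ∧ ArcsMeet T E

/-- Strict interlacing on the unit circle, whichever of the two sets is the smaller one. -/
def StrictlyInterlace (S T : Set ℂ) : Prop :=
  StrictlyInterlaceLE S T ∨ StrictlyInterlaceLE T S

end CMV

end

namespace CMV

open Real

/-! Eigenvalues are read off from a phase on the circle. Put w_0 = z and w_{k+1} = z (w_k - conj
α_k) / (1 - α_k w_k). On the circle w_k is a unimodular function of degree k + 1, and its argument
`phase` lifts to an increasing function of arg z. A point z with w_n(z) = conj b_n is an eigenvalue,
by an explicit eigenvector. There are n + 1 such points, which already fill the spectrum of a matrix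
of order n + 1 (`spectrum_matC`).

Let m be the lift of the last Möbius map. The phases for σ and σ' are related by phase_n(t) = t +
m(phase_{n-1}(t)). The σ' equation phase_{n-1} ≡ η mod 2π is equivalent to m(phase_{n-1}) ≡ m(η).
Measuring t from β - m(η), where β = arg(conj b_n), puts the origin at c = conj b_n γ_{n-1}. Then σ'
is the level set of one lift φ and σ that of t + φ(t), modulo 2π.

What remains concerns one increasing function (`interlacing_of_isLift`): a common level forces t ≡
0, so c is the only possible common point, and c lies in both sets or in neither. Interlacing
follows from the intermediate value theorem. -/

/-! ### Lifts of circle coverings and their level sets -/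

/-- `φ` is continuous, strictly increasing, and increases by `2πN` over each period: a lift to the
real line of an orientation-preserving covering of the circle of degree `N`. -/
structure IsLift (N : ℕ) (φ : ℝ → ℝ) : Prop where
  cont : Continuous φ
  mono : StrictMono φ
  add_period : ∀ t, φ (t + 2 * π) = φ t + 2 * π * N

/-- The point `c * exp (i t)`. -/
noncomputable def rot (c : ℂ) (t : ℝ) : ℂ := c * Complex.exp (t * Complex.I)

/-- The points `c * exp (i t)` for which `φ t` is an integer multiple of `2π`. -/
def levelSet (c : ℂ) (φ : ℝ → ℝ) : Set ℂ :=
  {z | ∃ (t : ℝ) (k : ℤ), z = rot c t ∧ φ t = 2 * π * k}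

theorem rot_eq_rot {c : ℂ} (hc : c ≠ 0) {s t : ℝ} :
    rot c s = rot c t ↔ ∃ k : ℤ, s = t + 2 * π * k := by
  unfold rot
  rw [mul_right_inj' hc, Complex.exp_eq_exp_iff_exists_int]
  refine exists_congr fun k => ⟨fun h => ?_, fun h => ?_⟩
  · have := congrArg Complex.im h
    simp at this
    linarith
  · rw [h]; push_cast; ring

theorem norm_rot (c : ℂ) (t : ℝ) : ‖rot c t‖ = ‖c‖ := by
  simp [rot, Complex.norm_exp_ofReal_mul_I]

theorem rot_zero (c : ℂ) : rot c 0 = c := by simp [rot]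

theorem rot_rot (c : ℂ) (s t : ℝ) : rot (rot c s) t = rot c (s + t) := by
  simp [rot, mul_assoc, ← Complex.exp_add, add_mul]

theorem exists_rot_one {z : ℂ} (hz : ‖z‖ = 1) : ∃ t : ℝ, z = rot 1 t :=
  ⟨z.arg, by have := Complex.norm_mul_exp_arg_mul_I z; simpa [hz, rot] using this.symm⟩

theorem exists_rot_eq {c z : ℂ} (hc : ‖c‖ = 1) (hz : ‖z‖ = 1) (s : ℝ) :
    ∃ t, s ≤ t ∧ t < s + 2 * π ∧ z = rot c t := by
  have hc0 : c ≠ 0 := norm_ne_zero_iff.1 (by rw [hc]; exact one_ne_zero)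
  obtain ⟨u, hu⟩ := exists_rot_one (z := z / c) (by simp [hc, hz])
  have hzu : z = rot c u := by
    rw [div_eq_iff hc0] at hu; rw [hu]; simp [rot, mul_comm]
  refine ⟨toIcoMod two_pi_pos s u, (toIcoMod_mem_Ico two_pi_pos s u).1,
    (toIcoMod_mem_Ico two_pi_pos s u).2, ?_⟩
  rw [hzu, rot_eq_rot hc0]
  refine ⟨toIcoDiv two_pi_pos s u, ?_⟩
  have := toIcoMod_add_toIcoDiv_zsmul two_pi_pos s u
  rw [zsmul_eq_mul] at this
  linarith

theorem arcsMeet_of_lift {c : ℂ} (hc : ‖c‖ = 1) {A B : Set ℂ} (hA : A ⊆ unitCircle)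
    (h : ∀ s t, s < t → t < s + 2 * π → rot c s ∈ A → rot c t ∈ A →
      ∃ u, s < u ∧ u < t ∧ rot c u ∈ B) : ArcsMeet A B := by
  intro p hp q hq hpq
  obtain ⟨s, -, -, rfl⟩ := exists_rot_eq hc (hA hp) 0
  obtain ⟨t, hst, hts, rfl⟩ := exists_rot_eq hc (hA hq) s
  have hlt : s < t := lt_of_le_of_ne hst fun e => hpq (by rw [e])
  obtain ⟨u, h1, h2, h3⟩ := h s t hlt hts hp hq
  refine ⟨rot c u, ⟨u - s, t - s, by linarith, by linarith, by linarith, ?_, ?_⟩, h3⟩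
  · have := rot_rot c s (u - s)
    rw [add_sub_cancel] at this
    exact this.symm
  · have := rot_rot c s (t - s)
    rw [add_sub_cancel] at this
    exact this.symm

namespace IsLift

variable {N : ℕ} {φ : ℝ → ℝ}

theorem add_int (h : IsLift N φ) (t : ℝ) (k : ℤ) : φ (t + 2 * π * k) = φ t + 2 * π * N * k := by
  induction k using Int.induction_on with
  | zero => simp
  | succ k ih =>
    have := h.add_period (t + 2 * π * (k : ℤ))
    rw [ih] at this
    push_cast at this ⊢
    rw [show t + 2 * π * ((k : ℝ) + 1) = t + 2 * π * k + 2 * π by ring, this]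
    ring
  | pred k ih =>
    have := h.add_period (t + 2 * π * ((-(k : ℤ) - 1 : ℤ) : ℝ))
    rw [show t + 2 * π * ((-(k : ℤ) - 1 : ℤ) : ℝ) + 2 * π = t + 2 * π * ((-(k : ℤ) : ℤ) : ℝ) by
      push_cast; ring, ih] at this
    push_cast at this ⊢
    linarith

theorem rot_mem (h : IsLift N φ) {c : ℂ} (hc : c ≠ 0) {t : ℝ} :
    rot c t ∈ levelSet c φ ↔ ∃ k : ℤ, φ t = 2 * π * k := by
  constructor
  · rintro ⟨s, k, hs, hk⟩
    obtain ⟨m, rfl⟩ := (rot_eq_rot hc).1 hs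
    exact ⟨k + N * m, by rw [h.add_int, hk]; push_cast; ring⟩
  · rintro ⟨k, hk⟩
    exact ⟨t, k, rfl, hk⟩

theorem surjective (h : IsLift N φ) (hN : 1 ≤ N) : Function.Surjective φ := by
  intro y
  have hN' : (1 : ℝ) ≤ N := by exact_mod_cast hN
  have hp : 0 < 2 * π * N := by positivity
  have h1 := Int.floor_le ((y - φ 0) / (2 * π * N))
  have h2 := Int.lt_floor_add_one ((y - φ 0) / (2 * π * N))
  set k := ⌊(y - φ 0) / (2 * π * N)⌋
  rw [le_div_iff₀ hp] at h1
  rw [div_lt_iff₀ hp] at h2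
  have e1 := h.add_int 0 k
  have e2 := h.add_int 0 (k + 1)
  push_cast at e2
  have hle : (0 : ℝ) + 2 * π * k ≤ 0 + 2 * π * (k + 1) := by nlinarith [pi_pos]
  obtain ⟨t, -, ht⟩ := intermediate_value_Icc hle h.cont.continuousOn
    (show y ∈ Set.Icc _ _ from ⟨by rw [e1]; linarith, by rw [e2]; linarith⟩)
  exact ⟨t, ht⟩

/-- One turn raises the level index by `N`, so the points correspond to the residues of the index
modulo `N`. -/
theorem levelSet_ncard (h : IsLift N φ) (hN : 1 ≤ N) {c : ℂ} (hc : c ≠ 0) :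
    (levelSet c φ).Finite ∧ (levelSet c φ).ncard = N := by
  obtain ⟨g, hg⟩ := (h.surjective hN).hasRightInverse
  have hN0 : (0 : ℤ) < N := by exact_mod_cast hN
  have himg : levelSet c φ = (fun j : ℤ => rot c (g (2 * π * j))) '' Set.Ico (0 : ℤ) N := by
    ext z
    constructor
    · rintro ⟨t, k, rfl, hk⟩
      refine ⟨k % N, ⟨Int.emod_nonneg _ hN0.ne', Int.emod_lt_of_pos _ hN0⟩, ?_⟩
      rw [rot_eq_rot hc]
      refine ⟨-(k / N), h.mono.injective ?_⟩
      rw [hg, h.add_int, hk]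
      have : (k : ℝ) = ((k % N + N * (k / N) : ℤ) : ℝ) := by rw [Int.emod_add_mul_ediv]
      rw [this]
      push_cast
      ring
    · rintro ⟨j, -, rfl⟩
      exact ⟨_, j, rfl, hg _⟩
  have hinj : Set.InjOn (fun j : ℤ => rot c (g (2 * π * j))) (Set.Ico (0 : ℤ) N) := by
    intro i hi j hj hij
    obtain ⟨m, hm⟩ := (rot_eq_rot hc).1 hij
    have := congrArg φ hm
    rw [hg, h.add_int, hg] at this
    have h2 : (i : ℝ) = ((j + N * m : ℤ) : ℝ) := by
      have h3 : 2 * π * (i : ℝ) = 2 * π * ((j + N * m : ℤ) : ℝ) := by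
        rw [this]; push_cast; ring
      exact mul_left_cancel₀ two_pi_pos.ne' h3
    have h4 : i = j + N * m := by exact_mod_cast h2
    rw [← Int.emod_eq_of_lt hi.1 hi.2, ← Int.emod_eq_of_lt hj.1 hj.2, h4]
    simp
  rw [himg]
  refine ⟨(Set.finite_Ico _ _).image _, ?_⟩
  rw [hinj.ncard_image, ← Finset.coe_Ico, Set.ncard_coe_finset]
  simp

theorem id_add {ψ : ℝ → ℝ} (h : IsLift N ψ) : IsLift (N + 1) fun t => t + ψ t where
  cont := continuous_id.add h.cont
  mono := strictMono_id.add h.mono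
  add_period t := by rw [h.add_period]; push_cast; ring

theorem comp {ψ : ℝ → ℝ} (hψ : IsLift 1 ψ) (h : IsLift N φ) : IsLift N fun t => ψ (φ t) where
  cont := hψ.cont.comp h.cont
  mono := hψ.mono.comp h.mono
  add_period t := by
    have := hψ.add_int (φ t) N
    rw [h.add_period]
    push_cast at this
    simpa using this

theorem shift (h : IsLift N φ) (a b : ℝ) : IsLift N fun t => φ (a + t) - b where
  cont := by have := h.cont; fun_prop
  mono s t hst := by have := h.mono (add_lt_add_right hst a); simpa using this
  add_period t := by rw [← add_assoc, h.add_period]; ring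

theorem exists_level_between (h : IsLift N φ) {x y : ℝ} {k : ℤ} (hxy : x < y)
    (hx : φ x < 2 * π * k) (hy : 2 * π * k < φ y) : ∃ u, x < u ∧ u < y ∧ φ u = 2 * π * k := by
  obtain ⟨u, hu, e⟩ := intermediate_value_Ioo hxy.le h.cont.continuousOn ⟨hx, hy⟩
  exact ⟨u, hu.1, hu.2, e⟩

end IsLift

theorem exists_int_bounds_of_no_level {f : ℝ → ℝ} (hf : Continuous f)
    {s t : ℝ} (hst : s < t) (hs : ∀ k : ℤ, f s ≠ 2 * π * k)
    (h : ∀ u, s < u → u < t → ∀ k : ℤ, f u ≠ 2 * π * k) :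
    ∃ k : ℤ, 2 * π * k < f s ∧ f t ≤ 2 * π * (k + 1) := by
  refine ⟨⌊f s / (2 * π)⌋, lt_of_le_of_ne ?_ (hs _).symm, ?_⟩
  · have := Int.floor_le (f s / (2 * π))
    rw [le_div_iff₀ two_pi_pos] at this
    linarith
  · by_contra hlt
    have h2 := Int.lt_floor_add_one (f s / (2 * π))
    rw [div_lt_iff₀ two_pi_pos] at h2
    obtain ⟨u, hu, e⟩ := intermediate_value_Ioo hst.le hf.continuousOn
      (show 2 * π * ((⌊f s / (2 * π)⌋ : ℝ) + 1) ∈ Set.Ioo _ _ from ⟨by linarith, not_le.1 hlt⟩)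
    exact h u hu.1 hu.2 (⌊f s / (2 * π)⌋ + 1) (by rw [e]; push_cast; ring)

/-! ### Interlacing of the levels of `φ` and `t + φ t` -/

section Interlacing

variable {N : ℕ} {φ : ℝ → ℝ} {c : ℂ}

theorem levelSet_subset_unitCircle (hc : ‖c‖ = 1) : levelSet c φ ⊆ unitCircle := by
  rintro z ⟨t, k, rfl, -⟩
  exact (norm_rot c t).trans hc

theorem rot_eq_self (hc : c ≠ 0) {t : ℝ} : rot c t = c ↔ ∃ k : ℤ, t = 2 * π * k := by
  conv_lhs => rw [← rot_zero c, rot_rot, rot_eq_rot hc]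
  simp

/-- If neither `t` nor `φ t` meets a level on the way, each stays within one interval of length 2π
between consecutive levels. Their sum then has only one level available, yet it increases strictly
from one level to another. -/
theorem arcsMeet_levelSet_diff (h : IsLift N φ) (hc : ‖c‖ = 1) :
    ArcsMeet (levelSet c (fun t => t + φ t) \ (levelSet c φ ∪ {c})) (levelSet c φ ∪ {c}) := by
  have hc0 : c ≠ 0 := norm_ne_zero_iff.1 (by rw [hc]; exact one_ne_zero)
  have key : ∀ u, rot c u ∉ levelSet c φ ∪ {c} →
      (∀ k : ℤ, u ≠ 2 * π * k) ∧ ∀ k : ℤ, φ u ≠ 2 * π * k := by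
    intro u hu
    simp only [Set.mem_union, Set.mem_singleton_iff, not_or, h.rot_mem hc0, rot_eq_self hc0,
      not_exists] at hu
    exact ⟨hu.2, hu.1⟩
  refine arcsMeet_of_lift hc (Set.sdiff_subset.trans (levelSet_subset_unitCircle hc)) ?_
  rintro s t hst - ⟨hs, hs'⟩ ⟨ht, ht'⟩
  by_contra! hno
  obtain ⟨ks, hks⟩ := (h.id_add.rot_mem hc0).1 hs
  obtain ⟨kt, hkt⟩ := (h.id_add.rot_mem hc0).1 ht
  obtain ⟨a, ha, ha'⟩ := exists_int_bounds_of_no_level continuous_id hst (key s hs').1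
    fun u h1 h2 => (key u (hno u h1 h2)).1
  obtain ⟨b, hb, hb'⟩ := exists_int_bounds_of_no_level h.cont hst (key s hs').2
    fun u h1 h2 => (key u (hno u h1 h2)).2
  have hφt : φ t < 2 * π * (b + 1) :=
    lt_of_le_of_ne hb' fun e => (key t ht').2 (b + 1) (by rw [e]; push_cast; ring)
  have hlt := h.mono hst
  simp only [id] at ha ha'
  have h1 : 2 * π * ((a + b : ℤ) : ℝ) < 2 * π * (ks : ℝ) := by push_cast; linarith
  have h2 : 2 * π * (ks : ℝ) < 2 * π * (kt : ℝ) := by linarith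
  have h3 : 2 * π * (kt : ℝ) < 2 * π * ((a + b + 2 : ℤ) : ℝ) := by push_cast; linarith
  rw [mul_lt_mul_iff_right₀ two_pi_pos, Int.cast_lt] at h1 h2 h3
  omega

/-- Between two levels `φ` grows by at least 2π, so `u + φ u` grows by more than 2π and crosses a
level strictly inside. -/
theorem exists_level_of_level_of_level (h : IsLift N φ) {s t : ℝ} (hst : s < t) {a b : ℤ}
    (ha : φ s = 2 * π * a) (hb : φ t = 2 * π * b) :
    ∃ u, s < u ∧ u < t ∧ ∃ k : ℤ, u + φ u = 2 * π * k := by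
  have hab : a < b := by
    have := h.mono hst
    rw [ha, hb, mul_lt_mul_iff_right₀ two_pi_pos] at this
    exact_mod_cast this
  have hab' : (a : ℝ) + 1 ≤ b := by exact_mod_cast hab
  have hm : 2 * π * ((a : ℝ) + 1) ≤ 2 * π * b := mul_le_mul_of_nonneg_left hab' two_pi_pos.le
  have h1 := Int.floor_le ((s + φ s) / (2 * π))
  have h2 := Int.lt_floor_add_one ((s + φ s) / (2 * π))
  rw [le_div_iff₀ two_pi_pos] at h1
  rw [div_lt_iff₀ two_pi_pos] at h2
  obtain ⟨u, hu, hu', e⟩ := h.id_add.exists_level_between (k := ⌊(s + φ s) / (2 * π)⌋ + 1) hst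
    (by push_cast; linarith) (by push_cast; linarith)
  exact ⟨u, hu, hu', _, e⟩

theorem arcsMeet_levelSet_of_mem (h : IsLift N φ) (hc : ‖c‖ = 1) (h0 : c ∈ levelSet c φ) :
    ArcsMeet (levelSet c φ) (levelSet c (fun t => t + φ t) \ {c}) := by
  have hc0 : c ≠ 0 := norm_ne_zero_iff.1 (by rw [hc]; exact one_ne_zero)
  refine arcsMeet_of_lift hc (levelSet_subset_unitCircle hc) ?_
  intro s t hst hts hs ht
  obtain ⟨a, ha⟩ := (h.rot_mem hc0).1 hs
  obtain ⟨b, hb⟩ := (h.rot_mem hc0).1 ht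
  -- The point found must differ from `c`. If the arc passes through `c`, itself a level point of
  -- `φ`, only the part before `c` is used.
  by_cases hk : ∃ k : ℤ, s < 2 * π * k ∧ 2 * π * k < t
  · obtain ⟨k, hk1, hk2⟩ := hk
    obtain ⟨d, hd⟩ := (h.rot_mem hc0).1 (show rot c (2 * π * k) ∈ levelSet c φ by
      rwa [(rot_eq_self hc0).2 ⟨k, rfl⟩])
    obtain ⟨u, hu1, hu2, m, hm⟩ := exists_level_of_level_of_level h hk1 ha hd
    refine ⟨u, hu1, hu2.trans hk2, (h.id_add.rot_mem hc0).2 ⟨m, hm⟩, fun e => ?_⟩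
    obtain ⟨j, rfl⟩ := (rot_eq_self hc0).1 e
    have h1 := hu2
    have h2 : 2 * π * (k : ℝ) < 2 * π * ((j + 1 : ℤ) : ℝ) := by push_cast; linarith
    rw [mul_lt_mul_iff_right₀ two_pi_pos, Int.cast_lt] at h1 h2
    omega
  · push Not at hk
    obtain ⟨u, hu1, hu2, m, hm⟩ := exists_level_of_level_of_level h hst ha hb
    refine ⟨u, hu1, hu2, (h.id_add.rot_mem hc0).2 ⟨m, hm⟩, fun e => ?_⟩
    obtain ⟨j, rfl⟩ := (rot_eq_self hc0).1 e
    exact (hk j hu1).not_gt hu2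

/-- With `φ` at level `a` at one end and `t` at `2πb` at the other, the sum crosses level `a + b`.
Two ends at `c` would be a full turn apart. -/
theorem arcsMeet_levelSet_union (h : IsLift N φ) (hc : ‖c‖ = 1) :
    ArcsMeet (levelSet c φ ∪ {c}) (levelSet c (fun t => t + φ t)) := by
  have hc0 : c ≠ 0 := norm_ne_zero_iff.1 (by rw [hc]; exact one_ne_zero)
  refine arcsMeet_of_lift hc
    (Set.union_subset (levelSet_subset_unitCircle hc) (Set.singleton_subset_iff.2 hc)) ?_
  simp only [h.rot_mem hc0, h.id_add.rot_mem hc0, Set.mem_union, Set.mem_singleton_iff,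
    rot_eq_self hc0]
  rintro s t hst hts (⟨a, ha⟩ | ⟨a, ha⟩) (⟨b, hb⟩ | ⟨b, hb⟩)
  · exact exists_level_of_level_of_level h hst ha hb
  · have := h.mono hst
    obtain ⟨u, h1, h2, e⟩ := h.id_add.exists_level_between (k := a + b) hst
      (by push_cast; linarith) (by push_cast; linarith)
    exact ⟨u, h1, h2, _, e⟩
  · have := h.mono hst
    obtain ⟨u, h1, h2, e⟩ := h.id_add.exists_level_between (k := a + b) hst
      (by push_cast; linarith) (by push_cast; linarith)
    exact ⟨u, h1, h2, _, e⟩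
  · have h2 : 2 * π * (b : ℝ) < 2 * π * ((a + 1 : ℤ) : ℝ) := by push_cast; linarith
    rw [ha, hb] at hst
    rw [mul_lt_mul_iff_right₀ two_pi_pos, Int.cast_lt] at h2 hst
    omega

theorem strictlyInterlace_of_ncard_eq {S T : Set ℂ} (hS : S.Finite) (hT : T.Finite)
    (hS' : S ⊆ unitCircle) (hT' : T ⊆ unitCircle) (h1 : 1 ≤ S.ncard) (hST : S.ncard = T.ncard)
    (h : ArcsMeet S T) (h' : ArcsMeet T S) : StrictlyInterlace S T :=
  Or.inl ⟨hS, hT, hS', hT', h1, hST.le, S, hS, subset_rfl, hS', hST, h, h'⟩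

theorem interlacing_of_isLift (h : IsLift N φ) (hN : 1 ≤ N) (hc : ‖c‖ = 1) {σ σ' : Set ℂ}
    (hσ : σ = levelSet c fun t => t + φ t) (hσ' : σ' = levelSet c φ) :
    (σ ∩ σ').encard ≤ 1 ∧
      ((σ ∩ σ' = {c} ∧ StrictlyInterlace (σ \ {c}) σ') ∨
        (σ ∩ σ' = ∅ ∧ c ∉ σ ∧ c ∉ σ' ∧ StrictlyInterlace σ (σ' ∪ {c}))) := by
  have hc0 : c ≠ 0 := norm_ne_zero_iff.1 (by rw [hc]; exact one_ne_zero)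
  have hsub : σ ∩ σ' ⊆ {c} := by
    rintro z ⟨hz, hz'⟩
    rw [hσ'] at hz'
    obtain ⟨t, k, rfl, hk⟩ := hz'
    rw [hσ, h.id_add.rot_mem hc0] at hz
    obtain ⟨m, hm⟩ := hz
    exact (rot_eq_self hc0).2 ⟨m - k, by push_cast; linarith⟩
  have hiff : c ∈ σ ↔ c ∈ σ' := by
    have h1 := h.rot_mem hc0 (t := 0)
    have h2 := h.id_add.rot_mem hc0 (t := 0)
    rw [rot_zero] at h1 h2
    rw [hσ, hσ', h1, h2]
    simp
  obtain ⟨fσ, nσ⟩ := h.id_add.levelSet_ncard (by omega) hc0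
  obtain ⟨fσ', nσ'⟩ := h.levelSet_ncard hN hc0
  have uσ := levelSet_subset_unitCircle (φ := fun t => t + φ t) hc
  have uσ' := levelSet_subset_unitCircle (φ := φ) hc
  have hd := arcsMeet_levelSet_diff h hc
  rw [← hσ] at fσ nσ uσ hd
  rw [← hσ'] at fσ' nσ' uσ' hd
  refine ⟨(Set.encard_le_encard hsub).trans (Set.encard_singleton c).le, ?_⟩
  by_cases hcm : c ∈ σ'
  · have hcs := hiff.2 hcm
    have hi : σ ∩ σ' = {c} := hsub.antisymm (by simpa using ⟨hcs, hcm⟩)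
    refine Or.inl ⟨hi, ?_⟩
    have hn : (σ \ {c}).ncard = N := by
      rw [Set.ncard_sdiff_singleton_of_mem hcs, nσ, Nat.add_sub_cancel]
    have ha := arcsMeet_levelSet_of_mem h hc (hσ' ▸ hcm)
    rw [← hσ, ← hσ'] at ha
    have hu : σ' ∪ {c} = σ' := Set.union_eq_left.2 (by simpa using hcm)
    rw [hu, ← Set.sdiff_inter_self_eq_sdiff, Set.inter_comm, hi] at hd
    exact strictlyInterlace_of_ncard_eq fσ.sdiff fσ' (Set.sdiff_subset.trans uσ) uσ'
      (by omega) (by omega) hd ha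
  · have hcs : c ∉ σ := fun hx => hcm (hiff.1 hx)
    have hi : σ ∩ σ' = ∅ := by
      rw [Set.eq_empty_iff_forall_notMem]
      intro z hz
      obtain rfl := hsub hz
      exact hcm hz.2
    refine Or.inr ⟨hi, hcs, hcm, ?_⟩
    have hn : (σ' ∪ {c}).ncard = N + 1 := by
      rw [Set.union_singleton, Set.ncard_insert_of_notMem hcm fσ', nσ']
    have ha := arcsMeet_levelSet_union h hc
    rw [← hσ, ← hσ'] at ha
    have hu : σ \ (σ' ∪ {c}) = σ := by
      rw [sdiff_eq_left, Set.disjoint_union_right, Set.disjoint_singleton_right]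
      exact ⟨Set.disjoint_iff_inter_eq_empty.2 hi, hcs⟩
    rw [hu] at hd
    exact strictlyInterlace_of_ncard_eq fσ (fσ'.union (Set.finite_singleton c)) uσ
      (Set.union_subset uσ' (Set.singleton_subset_iff.2 hc)) (by omega) (by omega) hd ha

end Interlacing

/-! ### The Möbius lift -/

/-- A lift of the action of the Möbius transformation `w ↦ (w - conj a) / (1 - a w)` on the unit
circle. -/
noncomputable def moebiusLift (a : ℂ) (t : ℝ) : ℝ := t - 2 * Complex.arg (1 - a * rot 1 t)

theorem rot_one_ne_zero (t : ℝ) : rot 1 t ≠ 0 :=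
  norm_ne_zero_iff.1 (by rw [norm_rot, norm_one]; exact one_ne_zero)

theorem continuous_rot (c : ℂ) : Continuous (rot c) := by unfold rot; fun_prop

theorem rot_one_add (s t : ℝ) : rot 1 (s + t) = rot 1 s * rot 1 t := by
  simp [rot, ← Complex.exp_add, add_mul]

theorem rot_one_mul_conj (t : ℝ) : rot 1 t * conj (rot 1 t) = 1 := by
  rw [Complex.mul_conj, Complex.normSq_eq_norm_sq, norm_rot]; simp

theorem one_sub_mem_slitPlane {a w : ℂ} (ha : ‖a‖ < 1) (hw : ‖w‖ = 1) :
    1 - a * w ∈ Complex.slitPlane := by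
  have := Complex.mem_slitPlane_of_norm_lt_one (z := -(a * w)) (by simpa [hw] using ha)
  rwa [← sub_eq_add_neg] at this

theorem one_sub_ne_zero {a w : ℂ} (ha : ‖a‖ < 1) (hw : ‖w‖ = 1) : 1 - a * w ≠ 0 :=
  Complex.slitPlane_ne_zero (one_sub_mem_slitPlane ha hw)

/-- For |w| = 1 and u = 1 - a w, w - conj a = w conj u, so the quotient is w (conj u / u) = w
exp(-2i arg u). -/
theorem rot_moebiusLift {a : ℂ} (ha : ‖a‖ < 1) (t : ℝ) :
    rot 1 (moebiusLift a t) = (rot 1 t - conj a) / (1 - a * rot 1 t) := by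
  have hu := one_sub_ne_zero ha ((norm_rot 1 t).trans norm_one)
  rw [eq_div_iff hu]
  have h1 : moebiusLift a t = t + -(1 - a * rot 1 t).arg + -(1 - a * rot 1 t).arg := by
    unfold moebiusLift; ring
  have h2 : (‖1 - a * rot 1 t‖ : ℂ) * rot 1 (1 - a * rot 1 t).arg = 1 - a * rot 1 t := by
    simp [rot]
  have h3 : rot 1 (-(1 - a * rot 1 t).arg) * rot 1 (1 - a * rot 1 t).arg = 1 := by
    rw [← rot_one_add, neg_add_cancel, rot_zero]
  have h4 : rot 1 (-(1 - a * rot 1 t).arg) = conj (rot 1 (1 - a * rot 1 t).arg) := by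
    simp [rot, ← Complex.exp_conj]
  have h5 : (‖1 - a * rot 1 t‖ : ℂ) * rot 1 (-(1 - a * rot 1 t).arg)
      = 1 - conj a * conj (rot 1 t) := by
    rw [h4]
    simpa only [map_mul, map_sub, map_one, Complex.conj_ofReal] using congrArg conj h2
  have h6 := rot_one_mul_conj t
  rw [h1, rot_one_add, rot_one_add]
  calc _ = rot 1 t * rot 1 (-(1 - a * rot 1 t).arg) * (rot 1 (-(1 - a * rot 1 t).arg) *
        ((‖1 - a * rot 1 t‖ : ℂ) * rot 1 (1 - a * rot 1 t).arg)) := by rw [h2]; ring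
    _ = rot 1 t * ((‖1 - a * rot 1 t‖ : ℂ) * rot 1 (-(1 - a * rot 1 t).arg)) := by
      linear_combination rot 1 t * rot 1 (-(1 - a * rot 1 t).arg) * (‖1 - a * rot 1 t‖ : ℂ) * h3
    _ = _ := by rw [h5]; linear_combination -conj a * h6

theorem moebius_injOn {a x y : ℂ} (ha : ‖a‖ < 1) (hx : ‖x‖ = 1) (hy : ‖y‖ = 1)
    (h : (x - conj a) / (1 - a * x) = (y - conj a) / (1 - a * y)) : x = y := by
  rw [div_eq_div_iff (one_sub_ne_zero ha hx) (one_sub_ne_zero ha hy)] at h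
  have h1 : (x - y) * (1 - a * conj a) = 0 := by linear_combination h
  refine sub_eq_zero.1 ((mul_eq_zero.1 h1).resolve_right ?_)
  rw [Complex.mul_conj, Complex.normSq_eq_norm_sq]
  norm_cast
  nlinarith [norm_nonneg a]

theorem isLift_moebiusLift {a : ℂ} (ha : ‖a‖ < 1) : IsLift 1 (moebiusLift a) := by
  have hper : ∀ (t : ℝ) (k : ℤ), moebiusLift a (t + 2 * π * k) = moebiusLift a t + 2 * π * k := by
    intro t k
    unfold moebiusLift
    rw [(rot_eq_rot one_ne_zero (s := t + 2 * π * k) (t := t)).2 ⟨k, rfl⟩]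
    ring
  have hcont : Continuous (moebiusLift a) := by
    refine continuous_id.sub (continuous_const.mul (continuous_iff_continuousAt.2 fun t => ?_))
    exact (Complex.continuousAt_arg (one_sub_mem_slitPlane ha ((norm_rot 1 t).trans norm_one))).comp
      (f := fun t => 1 - a * rot 1 t)
      (continuous_const.sub (continuous_const.mul (continuous_rot 1))).continuousAt
  have hinj : Function.Injective (moebiusLift a) := by
    intro x y hxy
    have h1 := congrArg (rot 1) hxy
    rw [rot_moebiusLift ha, rot_moebiusLift ha] at h1
    obtain ⟨k, rfl⟩ := (rot_eq_rot one_ne_zero).1 (moebius_injOn ha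
      ((norm_rot 1 x).trans norm_one) ((norm_rot 1 y).trans norm_one) h1)
    rw [hper] at hxy
    linarith
  refine ⟨hcont, ?_, fun t => by simpa using hper t 1⟩
  -- A continuous injection is strictly monotone; the 2π shift excludes decrease.
  refine (hcont.strictMono_of_inj hinj).resolve_right fun hanti => ?_
  have h1 := hanti two_pi_pos
  have h2 := hper 0 1
  simp only [zero_add, Int.cast_one, mul_one] at h2
  linarith [two_pi_pos]

/-! ### Phases and explicit eigenvectors -/

/-- A lift to the real line of the Blaschke product `z Φ_k(z) / Φ_k^*(z)`, where `Φ_k` are the monic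
orthogonal polynomials with Verblunsky coefficients `a`. -/
noncomputable def phase (a : ℕ → ℂ) : ℕ → ℝ → ℝ
  | 0 => fun t => t
  | k + 1 => fun t => t + moebiusLift (a k) (phase a k t)

theorem isLift_phase {a : ℕ → ℂ} (ha : ∀ k, ‖a k‖ < 1) (k : ℕ) : IsLift (k + 1) (phase a k) := by
  induction k with
  | zero => exact ⟨continuous_id, strictMono_id, fun t => by simp [phase]⟩
  | succ k ih => exact ((isLift_moebiusLift (ha k)).comp ih).id_add

/-- The normalizing factor of the `k`-th components of the eigenvector for `rot 1 t`. -/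
noncomputable def eigAmp (a : ℕ → ℂ) (t : ℝ) : ℕ → ℂ
  | 0 => 1
  | k + 1 => (1 - a k * rot 1 (phase a k t)) * eigAmp a t k / (√(1 - ‖a k‖ ^ 2) : ℝ) /
      if Even k then rot 1 t else 1

/-- The components of the eigenvector of `LM` for the eigenvalue `rot 1 t`. -/
noncomputable def eigVec (a : ℕ → ℂ) (t : ℝ) (k : ℕ) : ℂ :=
  if Even k then rot 1 (phase a k t) * eigAmp a t k / rot 1 t else eigAmp a t k

/-- The components of the image under `M` of the eigenvector of `LM` for the eigenvalue
`rot 1 t`. -/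
noncomputable def eigVecM (a : ℕ → ℂ) (t : ℝ) (k : ℕ) : ℂ :=
  if Even k then eigAmp a t k else rot 1 (phase a k t) * eigAmp a t k

theorem rho_ne_zero {a : ℂ} (ha : ‖a‖ < 1) : ((√(1 - ‖a‖ ^ 2) : ℝ) : ℂ) ≠ 0 := by
  have : 0 < √(1 - ‖a‖ ^ 2) := sqrt_pos.2 (by nlinarith [norm_nonneg a])
  exact_mod_cast this.ne'

theorem rho_sq {a : ℂ} (ha : ‖a‖ < 1) :
    ((√(1 - ‖a‖ ^ 2) : ℝ) : ℂ) ^ 2 = 1 - a * conj a := by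
  rw [Complex.mul_conj, Complex.normSq_eq_norm_sq]
  have := sq_sqrt (show 0 ≤ 1 - ‖a‖ ^ 2 by nlinarith [norm_nonneg a])
  exact_mod_cast this

theorem rot_phase_succ {a : ℕ → ℂ} (ha : ∀ k, ‖a k‖ < 1) (k : ℕ) (t : ℝ) :
    rot 1 (phase a (k + 1) t) = rot 1 t * ((rot 1 (phase a k t) - conj (a k)) /
      (1 - a k * rot 1 (phase a k t))) := by
  rw [phase, rot_one_add, rot_moebiusLift (ha k)]

/-- With amplitudes A_k, the block Θ(α_k) sends (A_k, w_{k+1} A_{k+1}) to (w_k A_k, z A_{k+1}); the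
recursions for w and A are this 2-by-2 system solved. -/
theorem theta_step_even {a : ℕ → ℂ} (ha : ∀ k, ‖a k‖ < 1) (t : ℝ) {k : ℕ} (hk : Even k) :
    conj (a k) * eigVecM a t k + (√(1 - ‖a k‖ ^ 2) : ℝ) * eigVecM a t (k + 1)
        = rot 1 t * eigVec a t k ∧
      (√(1 - ‖a k‖ ^ 2) : ℝ) * eigVecM a t k + -a k * eigVecM a t (k + 1)
        = rot 1 t * eigVec a t (k + 1) := by
  have h1 := rot_one_ne_zero t
  have h2 := one_sub_ne_zero (ha k) ((norm_rot 1 (phase a k t)).trans norm_one)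
  have h3 := rho_ne_zero (ha k)
  have h4 := rho_sq (ha k)
  have hk' : ¬ Even (k + 1) := by simpa [Nat.even_add_one] using hk
  simp only [eigVec, eigVecM, if_pos hk, if_neg hk', rot_phase_succ ha, eigAmp]
  generalize rot 1 t = z at *
  generalize rot 1 (phase a k t) = w at *
  generalize ((√(1 - ‖a k‖ ^ 2) : ℝ) : ℂ) = ρ at *
  generalize hd : 1 - a k * w = d at *
  constructor
  · field_simp
    ring
  · field_simp
    linear_combination eigAmp a t k * (h4 + hd)

theorem theta_step_odd {a : ℕ → ℂ} (ha : ∀ k, ‖a k‖ < 1) (t : ℝ) {k : ℕ} (hk : ¬ Even k) :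
    conj (a k) * eigVec a t k + (√(1 - ‖a k‖ ^ 2) : ℝ) * eigVec a t (k + 1) = eigVecM a t k ∧
      (√(1 - ‖a k‖ ^ 2) : ℝ) * eigVec a t k + -a k * eigVec a t (k + 1)
        = eigVecM a t (k + 1) := by
  have h1 := rot_one_ne_zero t
  have h2 := one_sub_ne_zero (ha k) ((norm_rot 1 (phase a k t)).trans norm_one)
  have h3 := rho_ne_zero (ha k)
  have h4 := rho_sq (ha k)
  have hk' : Even (k + 1) := by simpa [Nat.even_add_one] using hk
  simp only [eigVec, eigVecM, if_neg hk, if_pos hk', rot_phase_succ ha, eigAmp]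
  generalize rot 1 t = z at *
  generalize rot 1 (phase a k t) = w at *
  generalize ((√(1 - ‖a k‖ ^ 2) : ℝ) : ℂ) = ρ at *
  generalize hd : 1 - a k * w = d at *
  constructor
  · field_simp
    ring
  · field_simp
    linear_combination eigAmp a t k * (h4 + hd)

/-! ### Block sums acting on vectors -/

theorem single_mulVec_apply {m : ℕ} (i j : Fin m) (x : ℂ) (u : ℕ → ℂ) (l : Fin m) :
    (Matrix.single i j x).mulVec (fun k => u k) l = if (l : ℕ) = i then x * u j else 0 := by
  rw [Matrix.single_mulVec]
  by_cases h : l = i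
  · subst h; simp
  · rw [Function.update_of_ne h, if_neg (fun e => h (Fin.ext e))]; rfl

theorem blockAt_mulVec_apply {n : ℕ} (k : Fin n) (A : Matrix (Fin 2) (Fin 2) ℂ) (u : ℕ → ℂ)
    (l : Fin (n + 1)) :
    (blockAt k A).mulVec (fun i => u i) l =
      (if (l : ℕ) = k then A 0 0 * u k + A 0 1 * u (k + 1) else 0) +
        if (l : ℕ) = k + 1 then A 1 0 * u k + A 1 1 * u (k + 1) else 0 := by
  simp only [blockAt, Matrix.add_mulVec, Pi.add_apply, single_mulVec_apply, Fin.val_castSucc,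
    Fin.val_succ]
  split_ifs <;> ring

/-- As `p` alternates, the chosen blocks are disjoint. They miss only `0` or `n`, where the 1-by-1
blocks sit. -/
theorem sum_range_blocks (p : ℕ → Prop) [DecidablePred p] (hp : ∀ k, p (k + 1) ↔ ¬ p k)
    (w : ℕ → ℂ) (n l : ℕ) :
    (∑ k ∈ Finset.range n,
      if p k then (if l = k then w k else 0) + (if l = k + 1 then w (k + 1) else 0) else 0) =
      if (p l ∧ l < n) ∨ (¬ p l ∧ 0 < l ∧ l ≤ n) then w l else 0 := by
  induction n with
  | zero => simp; omega
  | succ n ih =>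
    rw [Finset.sum_range_succ, ih]
    have := hp n
    rcases lt_trichotomy l n with h | rfl | h
    · grind
    · grind
    · rcases eq_or_ne l (n + 1) with rfl | h'
      · grind
      · grind

theorem sum_blockAt_mulVec_apply {n : ℕ} (p : ℕ → Prop) [DecidablePred p]
    (hp : ∀ k, p (k + 1) ↔ ¬ p k) (A : Fin n → Matrix (Fin 2) (Fin 2) ℂ) (u w : ℕ → ℂ)
    (h0 : ∀ k : Fin n, p k → A k 0 0 * u k + A k 0 1 * u (k + 1) = w k)
    (h1 : ∀ k : Fin n, p k → A k 1 0 * u k + A k 1 1 * u (k + 1) = w (k + 1)) (l : Fin (n + 1)) :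
    (∑ k : Fin n, if p k then blockAt k (A k) else 0).mulVec (fun i => u i) l =
      if (p l ∧ (l : ℕ) < n) ∨ (¬ p l ∧ 0 < (l : ℕ)) then w l else 0 := by
  have hl : (l : ℕ) ≤ n := Nat.lt_succ_iff.1 l.2
  have := sum_range_blocks p hp w n l
  simp only [hl, and_true] at this
  rw [← this, Matrix.sum_mulVec, Finset.sum_apply, Finset.sum_range]
  refine Finset.sum_congr rfl fun k _ => ?_
  by_cases hk : p k
  · rw [if_pos hk, if_pos hk, blockAt_mulVec_apply, h0 k hk, h1 k hk]
  · rw [if_neg hk, if_neg hk, Matrix.zero_mulVec, Pi.zero_apply]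

theorem matL_mulVec {n : ℕ} {a : ℕ → ℂ} (ha : ∀ k, ‖a k‖ < 1) {b : ℂ} {t : ℝ}
    (ht : rot 1 (phase a n t) = conj b) :
    (matL (fun k : Fin n => a k) b).mulVec (fun i => eigVecM a t i)
      = fun i : Fin (n + 1) => rot 1 t * eigVec a t i := by
  ext l
  have hl : (l : ℕ) ≤ n := Nat.lt_succ_iff.1 l.2
  have hlast : Even n → conj b * eigVecM a t n = rot 1 t * eigVec a t n := by
    intro hn
    have := rot_one_ne_zero t
    simp only [eigVec, eigVecM, if_pos hn, ht]
    field_simp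
  rw [matL, Matrix.add_mulVec, Pi.add_apply, sum_blockAt_mulVec_apply (fun k => Even k)
    (fun k => Nat.even_add_one) (fun k : Fin n => Theta (a k)) (eigVecM a t)
    (fun k => rot 1 t * eigVec a t k) (fun k hk => (theta_step_even ha t hk).1)
    (fun k hk => (theta_step_even ha t hk).2)]
  by_cases hn : Even n
  · rw [if_pos hn, single_mulVec_apply, Fin.val_last, hlast hn]
    grind
  · rw [if_neg hn, Matrix.zero_mulVec, Pi.zero_apply, add_zero]
    grind

theorem matM_mulVec {n : ℕ} {a : ℕ → ℂ} (ha : ∀ k, ‖a k‖ < 1) {b : ℂ} {t : ℝ}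
    (ht : rot 1 (phase a n t) = conj b) :
    (matM (fun k : Fin n => a k) b).mulVec (fun i => eigVec a t i) =
      fun i : Fin (n + 1) => eigVecM a t i := by
  ext l
  have hl : (l : ℕ) ≤ n := Nat.lt_succ_iff.1 l.2
  have hlast : ¬ Even n → conj b * eigVec a t n = eigVecM a t n := by
    intro hn
    simp only [eigVec, eigVecM, if_neg hn, ht]
  have hfirst : eigVec a t 0 = eigVecM a t 0 := by
    have := rot_one_ne_zero t
    simp [eigVec, eigVecM, eigAmp, phase, this]
  rw [matM, Matrix.add_mulVec, Matrix.add_mulVec, Pi.add_apply, Pi.add_apply,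
    sum_blockAt_mulVec_apply (fun k => Odd k)
    (fun k => Nat.odd_add_one) (fun k : Fin n => Theta (a k)) (eigVec a t)
    (fun k => eigVecM a t k) (fun k hk => (theta_step_odd ha t (Nat.not_even_iff_odd.2 hk)).1)
    (fun k hk => (theta_step_odd ha t (Nat.not_even_iff_odd.2 hk)).2), single_mulVec_apply]
  simp only [Fin.val_zero, one_mul, hfirst]
  by_cases hn : Odd n
  · rw [if_pos hn, single_mulVec_apply, Fin.val_last, hlast (Nat.not_even_iff_odd.2 hn)]
    grind
  · rw [if_neg hn, Matrix.zero_mulVec, Pi.zero_apply, add_zero]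
    grind

/-! ### The spectrum as a level set -/

theorem rot_mem_spectrum_matC {n : ℕ} {a : ℕ → ℂ} (ha : ∀ k, ‖a k‖ < 1) {b : ℂ} {t : ℝ}
    (ht : rot 1 (phase a n t) = conj b) :
    rot 1 t ∈ spectrum ℂ (matC (fun k : Fin n => a k) b) := by
  have h0 := rot_one_ne_zero t
  rw [← Matrix.spectrum_toLin', ← Module.End.hasEigenvalue_iff_mem_spectrum]
  refine Module.End.hasEigenvalue_of_hasEigenvector (x := fun i => eigVec a t i)
    ⟨Module.End.mem_eigenspace_iff.2 ?_, fun h => ?_⟩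
  · rw [Matrix.toLin'_apply, matC, ← Matrix.mulVec_mulVec, matM_mulVec ha ht, matL_mulVec ha ht]
    rfl
  · have := congrFun h 0
    simp [eigVec, eigAmp, phase, h0] at this

theorem spectrum_finite_ncard_le {m : ℕ} (A : Matrix (Fin m) (Fin m) ℂ) :
    (spectrum ℂ A).Finite ∧ (spectrum ℂ A).ncard ≤ m := by
  have h : spectrum ℂ A = (A.charpoly.roots.toFinset : Set ℂ) := by
    ext z
    rw [Matrix.mem_spectrum_iff_isRoot_charpoly]
    simp [A.charpoly_monic.ne_zero]
  rw [h]
  refine ⟨Finset.finite_toSet _, ?_⟩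
  rw [Set.ncard_coe_finset]
  calc _ ≤ _ := Multiset.toFinset_card_le _
    _ ≤ _ := A.charpoly.card_roots'
    _ = m := by simp

/-- The spectrum is the set of the points of the circle where the phase is that of `conj b`. -/
theorem spectrum_matC {n : ℕ} {a : ℕ → ℂ} (ha : ∀ k, ‖a k‖ < 1) {b : ℂ} {β : ℝ}
    (hβ : conj b = rot 1 β) (θ : ℝ) :
    spectrum ℂ (matC (fun k : Fin n => a k) b)
      = levelSet (rot 1 θ) fun t => phase a n (θ + t) - β := by
  have hlift := (isLift_phase ha n).shift θ β
  obtain ⟨-, hcard⟩ := hlift.levelSet_ncard (by omega) (rot_one_ne_zero θ)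
  obtain ⟨hf, hle⟩ := spectrum_finite_ncard_le (matC (fun k : Fin n => a k) b)
  symm
  -- The level set has `n + 1` points and the spectrum at most that many, so one inclusion suffices.
  refine Set.eq_of_subset_of_ncard_le ?_ (by omega) hf
  rintro z ⟨t, k, rfl, hk⟩
  rw [rot_rot]
  refine rot_mem_spectrum_matC ha ?_
  rw [hβ, rot_eq_rot one_ne_zero]
  exact ⟨k, by linarith⟩

end CMV

/-! ### Assembly -/

theorem corollary1 (n : ℕ) (hn : 1 ≤ n) (α : Fin n → ℂ) (hα : ∀ j, ‖α j‖ < 1)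
    (bn : ℂ) (hbn : ‖bn‖ = 1) (bm : ℂ) (hbm : ‖bm‖ = 1)
    (σ : Set ℂ) (hσ : σ = spectrum ℂ (CMV.matC α bn))
    (σ' : Set ℂ) (hσ' : σ' = spectrum ℂ
      (CMV.matC (fun j : Fin (n - 1) => α (j.castLE (Nat.sub_le n 1))) bm))
    (c : ℂ) (hc : c = conj bn * CMV.gam (α ⟨n - 1, Nat.sub_lt hn Nat.one_pos⟩) bm) :
    (σ ∩ σ').encard ≤ 1 ∧
      ((σ ∩ σ' = {c} ∧ CMV.StrictlyInterlace (σ \ {c}) σ') ∨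
        (σ ∩ σ' = ∅ ∧ c ∉ σ ∧ c ∉ σ' ∧ CMV.StrictlyInterlace σ (σ' ∪ {c}))) := by
  open CMV in
  obtain ⟨n, rfl⟩ : ∃ m, n = m + 1 := ⟨n - 1, by omega⟩
  simp only [Nat.add_sub_cancel] at hσ' hc
  -- Extension by 0 keeps all coefficients in the disk.
  let a : ℕ → ℂ := fun k => if h : k < n + 1 then α ⟨k, h⟩ else 0
  have ha : ∀ k, ‖a k‖ < 1 := by
    intro k
    by_cases h : k < n + 1
    · simp only [a, dif_pos h, hα]
    · simp only [a, dif_neg h, norm_zero, zero_lt_one]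
  have e1 : α = fun k : Fin (n + 1) => a k := by
    ext k; simp only [a, dif_pos k.2]
  have e2 : (fun j : Fin n => α (j.castLE (Nat.le_succ n))) = fun k : Fin n => a k := by
    ext k; simp only [a, dif_pos (Nat.lt_succ_of_lt k.2)]; rfl
  have e3 : α ⟨n, Nat.lt_succ_self n⟩ = a n := by simp only [a, dif_pos (Nat.lt_succ_self n)]
  obtain ⟨β, hβ⟩ := exists_rot_one (z := conj bn) (by simpa using hbn)
  obtain ⟨η, hη⟩ := exists_rot_one (z := conj bm) (by simpa using hbm)
  have hm := isLift_moebiusLift (ha n)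
  have hcr : c = rot 1 (β - moebiusLift (a n) η) := by
    have hbb : bm * conj bm = 1 := by
      rw [Complex.mul_conj, Complex.normSq_eq_norm_sq, hbm]; simp
    have hd : 1 - a n * conj bm ≠ 0 := one_sub_ne_zero (ha n) (by simpa using hbm)
    have hd' : conj (a n) * bm - 1 ≠ 0 := by
      intro h
      apply hd
      have := congrArg conj h
      simp only [map_sub, map_mul, Complex.conj_conj, map_one, map_zero] at this
      linear_combination -this
    have h1 : rot 1 (β - moebiusLift (a n) η) * rot 1 (moebiusLift (a n) η) = conj bn := by
      rw [← rot_one_add, sub_add_cancel, hβ]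
    refine mul_right_cancel₀ (rot_one_ne_zero (moebiusLift (a n) η)) ?_
    rw [h1, rot_moebiusLift (ha n), ← hη, hc, gam, e3]
    -- γ is the inverse of the Möbius image of `conj bm`.
    rw [mul_assoc, div_mul_div_comm, (div_eq_one_iff_eq (mul_ne_zero hd' hd)).2, mul_one]
    linear_combination (a n * conj (a n) - 1) * hbb
  have hlift := (hm.comp (isLift_phase ha n)).shift (β - moebiusLift (a n) η) (moebiusLift (a n) η)
  refine interlacing_of_isLift hlift (by omega) (by rw [hcr, norm_rot, norm_one]) ?_ ?_
  · rw [hσ, e1, spectrum_matC ha hβ (β - moebiusLift (a n) η), hcr]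
    congr 1
    ext t
    simp only [phase]
    ring
  · rw [hσ'.trans (congrArg (fun v : Fin n → ℂ => spectrum ℂ (matC v bm)) e2), spectrum_matC ha hη (β - moebiusLift (a n) η), hcr]
    ext z
    refine exists_congr fun t => ?_
    -- The Möbius lift is injective and commutes with shifts by 2π, so it preserves congruence to η
    -- modulo 2π.
    have key : (∃ k : ℤ, phase a n (β - moebiusLift (a n) η + t) - η = 2 * Real.pi * k) ↔
        ∃ k : ℤ, moebiusLift (a n) (phase a n (β - moebiusLift (a n) η + t))
          - moebiusLift (a n) η = 2 * Real.pi * k := by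
      refine exists_congr fun k => ?_
      have := hm.add_int η k
      rw [Nat.cast_one, mul_one] at this
      rw [sub_eq_iff_eq_add', sub_eq_iff_eq_add', ← this, hm.mono.injective.eq_iff]
    simp only [exists_and_left, key]
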